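/- **Setting.** A *module* is a partial map from class names to class definitions; a class definition has field names, a constructor, methods (with annotated parameters) and ghost fields (side-effect-free, possibly parametrised and recursive expressions). Statements are `skip`, sequencing, conditionals, assignment $x:=e$ of a heap-independent expression, field read $x:=y.f$, field write $x.f:=y$, method call $x:=y.m(\bar z)$, object creation $x:=\mathtt{new}\ C(\bar z)$ and $\mathtt{return}\ x$. A state $\sigma$ is a heap together with a non-empty stack of frames; a frame has an executing object $\mathtt{this}$, a local variable map and a continuation. Small-step execution is the usual one; fields are private to a class, and a call or object creation executes only if the arguments match the declared parameter annotations. For modules $M',M$ with disjoint domains, $M'\circ M$ is their union; $M$ is the internal and $M'$ the external module. An object (and a state, by its executing object) is *internal* if its class is in $\mathrm{dom}(M)$, otherwise *external*. The *external states semantics* $(M';M,\sigma)\rightsquigarrow(M';M,\sigma')$ holds if $\sigma,\sigma'$ are external and $\sigma'$ is reached from $\sigma$ by one or more steps of $M'\circ M$ through internal intermediate states only. $\sigma$ is *initial* if its heap is one field-less object of class $\mathtt{Object}$ and its stack is one frame in which only $\mathtt{this}$ is defined, with arbitrary code. $\mathit{Arising}(M',M,\sigma)$ means $(M';M,\sigma_0)\rightsquigarrow^*(M';M,\sigma)$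 for some initial $\sigma_0$. All modules $M$ are subject to the standing restriction that, whatever disjoint $M'$ they are linked with, in every state that execution of $M'\circ M$ reaches from an initial one, code executing on an internal object calls methods of internal objects only and creates objects of classes in $\mathrm{dom}(M)$ only. **Assertions** are $$A ::= e \mid e:C \mid \neg A\mid A\wedge A\mid A\vee A\mid A\to A\mid \forall x.[A]\mid\exists x.[A]\mid \langle e\ \mathsf{access}\ e\rangle\mid \mathsf{internal}(e)\mid \mathsf{external}(e)\mid\langle e\ \mathsf{calls}\ e.m(\bar e)\rangle .$$ Quantifiers range over the objects in the heap, and $\_$ is a wildcard caller. Object $o$ has access to $v$ if some field of $o$ holds $v$, or $o$ is the executing object of some frame in which a variable that occurs in the continuation holds $v$. $\langle e\ \mathsf{calls}\ e'.m(\bar e)\rangle$ says that the next statement is a call of $m$ by $e$ on $e'$ with arguments $\bar e$. $\mathsf{inside}(y)$ abbreviates $\forall x.[\langle x\ \mathsf{access}\ y\rangle\to\mathsf{internal}(x)]$. *Classical* assertions are built from $e$, $e:C$, connectives and quantifiers. $M,\sigma,\rho\models A$ denotes satisfaction in $\sigma$, where the free variables of $A$ are interpreted by a partial variable map $\rho$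 and $\mathtt{this}$ is the executing object of $\sigma$; ghost fields are taken from $M$. Interpreting a later state $\sigma'$ with the map $\rho$ of an earlier state $\sigma$ is adaptation, $\sigma'\triangleleft\sigma\models A$. Below, $M'$ ranges over modules disjoint from $M$, $\sigma$ (or $\sigma_1$) over states with $\mathit{Arising}(M',M,\sigma)$, and $\rho$ over partial maps from variables to values (objects allocated in that state, integers, booleans, null); satisfaction in all states is with this $\rho$. * $M\models A$ iff $\sigma\models A$ for all $M',\sigma,\rho$. * $M\models A'\Rightarrow \mathsf{Enc}(A)$ iff for all $M',\sigma,\sigma',\rho$: if $(M';M,\sigma)\rightsquigarrow(M';M,\sigma')$, $\sigma\models A\wedge A'$ and $\sigma'\triangleleft\sigma\models\neg A$, then $\sigma\models\langle\_\ \mathsf{calls}\ x.m(\bar z)\rangle\wedge\mathsf{internal}(x)$ for some $x,m,\bar z$. * $M\models\{P\}\,\mathtt{res}=x.m(\bar z)\,\{Q\}$ iff for all $M'$, every program state $\sigma$ (arising or not) and every $\rho$, if $\sigma$ satisfies $P$ and is about to execute a call $x.m(\bar z)$, and this call completes under $M'\circ M$, then the state right after it satisfies $Q$, with $\mathtt{res}$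 denoting the returned value. * $M\models \mathsf{from}\ A_1\ \mathsf{to1}\ A_2\ \mathsf{onlyIf}\ A$ iff for all $M',\sigma,\sigma',\rho$ with $(M';M,\sigma)\rightsquigarrow(M';M,\sigma')$, $\sigma\models A_1$ and $\sigma'\triangleleft\sigma\models A_2$: $\sigma\models A$. * $M\models \mathsf{from}\ A_1\ \mathsf{to}\ A_2\ \mathsf{onlyIf}\ A$: the same with $\rightsquigarrow^*$ for $\rightsquigarrow$. * $M\models \mathsf{from}\ A_1\ \mathsf{to}\ A_2\ \mathsf{onlyThrough}\ A$ iff for all $M'$, $\rho$ and all $\sigma_1\rightsquigarrow\cdots\rightsquigarrow\sigma_n$ ($n\ge1$) with $\sigma_1\models A_1$ and $\sigma_n\triangleleft\sigma_1\models A_2$ there is $i\in\{1,\dots,n\}$ with $\sigma_i\triangleleft\sigma_1\models A$. **The logic.** Let judgments $M\vdash A$, $M\vdash A'\Rightarrow\mathsf{Enc}(A)$ and $M\vdash\{P\}\,\mathtt{res}=x.m(\bar z)\,\{Q\}$ be given. $M\vdash S$, for Necessity specifications $S$ (the three forms above), is the least relation closed under the following rules ($P,P_1,P_2$ classical). * If1-Classical: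 if $C\in\mathrm{dom}(M)$, $\mathtt{res}$ is not free in $P_2$ and $M\vdash\{x:C\wedge P_1\wedge\neg P\}\,\mathtt{res}=x.m(\bar z)\,\{\neg P_2\}$, then $M\vdash\mathsf{from}\ P_1\wedge x:C\wedge\langle\_\ \mathsf{calls}\ x.m(\bar z)\rangle\ \mathsf{to1}\ P_2\ \mathsf{onlyIf}\ P$. * If1-Inside: if $C\in\mathrm{dom}(M)$ and $M\vdash\{x:C\wedge\neg P\}\,\mathtt{res}=x.m(\bar z)\,\{\mathtt{res}\ne y\}$, then $M\vdash\mathsf{from}\ \mathsf{inside}(y)\wedge x:C\wedge\langle\_\ \mathsf{calls}\ x.m(\bar z)\rangle\ \mathsf{to1}\ \neg\mathsf{inside}(y)\ \mathsf{onlyIf}\ P$. * If1-Internal: if for all $C\in\mathrm{dom}(M)$ and all methods $m$ of $C$, $M\vdash\mathsf{from}\ A_1\wedge x:C\wedge\langle\_\ \mathsf{calls}\ x.m(\bar z)\rangle\ \mathsf{to1}\ A_2\ \mathsf{onlyIf}\ A_3$ (with $x,\bar z$ distinct and not free in $A_1,A_2,A_3$, and $\bar z$ as long as the parameter list of $m$),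 $M\vdash A_1\to\neg A_2$ and $M\vdash A_1\Rightarrow\mathsf{Enc}(\neg A_2)$, then $M\vdash\mathsf{from}\ A_1\ \mathsf{to1}\ A_2\ \mathsf{onlyIf}\ A_3$. * If1-$\to$: from $M\vdash A_1\to A_1'$, $M\vdash A_2\to A_2'$, $M\vdash A_3'\to A_3$ and $M\vdash\mathsf{from}\ A_1'\ \mathsf{to1}\ A_2'\ \mathsf{onlyIf}\ A_3'$ infer $M\vdash\mathsf{from}\ A_1\ \mathsf{to1}\ A_2\ \mathsf{onlyIf}\ A_3$. * If1-$\vee$E: from $M\vdash\mathsf{from}\ A_1\ \mathsf{to1}\ A_2\ \mathsf{onlyIf}\ A\vee A'$ and $M\vdash\mathsf{from}\ A'\ \mathsf{to}\ A_2\ \mathsf{onlyThrough}\ \mathsf{false}$ infer $M\vdash\mathsf{from}\ A_1\ \mathsf{to1}\ A_2\ \mathsf{onlyIf}\ A$. * If1-$\exists_1$: if $M\vdash\mathsf{from}\ [y/x]A_1\ \mathsf{to1}\ A_2\ \mathsf{onlyIf}\ A$ for all variables $y$ that are not bound in $A_1$, then $M\vdash\mathsf{from}\ \exists x.[A_1]\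 \mathsf{to1}\ A_2\ \mathsf{onlyIf}\ A$. * Changes: from $M\vdash\mathsf{from}\ A\ \mathsf{to1}\ \neg A\ \mathsf{onlyIf}\ A'$ infer $M\vdash\mathsf{from}\ A\ \mathsf{to}\ \neg A\ \mathsf{onlyThrough}\ A'$. * Trans$_1$, Trans$_2$: from $M\vdash\mathsf{from}\ A_1\ \mathsf{to}\ A_2\ \mathsf{onlyThrough}\ A_3$ and either $M\vdash\mathsf{from}\ A_1\ \mathsf{to}\ A_3\ \mathsf{onlyThrough}\ A$ or $M\vdash\mathsf{from}\ A_3\ \mathsf{to}\ A_2\ \mathsf{onlyThrough}\ A$ infer $M\vdash\mathsf{from}\ A_1\ \mathsf{to}\ A_2\ \mathsf{onlyThrough}\ A$. * If: from $M\vdash\mathsf{from}\ A_1\ \mathsf{to}\ A_2\ \mathsf{onlyIf}\ A$ infer $M\vdash\mathsf{from}\ A_1\ \mathsf{to}\ A_2\ \mathsf{onlyThrough}\ A$. End: $M\vdash\mathsf{from}\ A_1\ \mathsf{to}\ A_2\ \mathsf{onlyThrough}\ A_2$. * If-Trans: from $M\vdash\mathsf{from}\ A_1\ \mathsf{to}\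 A_2\ \mathsf{onlyThrough}\ A_3$ and $M\vdash\mathsf{from}\ A_1\ \mathsf{to}\ A_3\ \mathsf{onlyIf}\ A$ infer $M\vdash\mathsf{from}\ A_1\ \mathsf{to}\ A_2\ \mathsf{onlyIf}\ A$. * If-Class: $M\vdash\mathsf{from}\ x:C\ \mathsf{to}\ \neg(x:C)\ \mathsf{onlyIf}\ \mathsf{false}$. If-Start: $M\vdash\mathsf{from}\ A_1\ \mathsf{to}\ A_2\ \mathsf{onlyIf}\ A_1$. **Theorem (Soundness).** Suppose that the three given judgments are sound, that is, for all modules $M$ (subject to the standing restriction): $M\vdash A$ implies $M\models A$; $M\vdash A'\Rightarrow\mathsf{Enc}(A)$ implies $M\models A'\Rightarrow\mathsf{Enc}(A)$; and, for classical $P,Q$, $M\vdash\{P\}\,\mathtt{res}=x.m(\bar z)\,\{Q\}$ implies $M\models\{P\}\,\mathtt{res}=x.m(\bar z)\,\{Q\}$. Then for every such module $M$ and every Necessity specification $S$, $$M\vdash S\quad\text{implies}\quad M\models S .$$ -/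

import Mathlib

namespace Necessity

/-! ## Syntax of the object language -/

abbrev ClassName := ℕ
abbrev FieldName := ℕ
abbrev MethName := ℕ
abbrev GhostName := ℕ
/-- Names of variables (of programs and of assertions). -/
abbrev Name := ℕ
abbrev Addr := ℕ

inductive Val
  | null
  | bool (b : Bool)
  | int (i : ℤ)
  | addr (α : Addr)
  deriving DecidableEq

/-- Type annotations of formal parameters. -/
inductive Ty
  | any
  | bool
  | int
  | cls (C : ClassName)

/-- A readable variable: the keyword `this` (which cannot be assigned), or a name. -/
inductive Opd
  | this
  | var (x : Name)

/-- Side-effect-free expressions. `ghost e g args` reads the (parametrised) ghost field `g` of `e`. -/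
inductive Expr
  | opd (z : Opd)
  | null
  | bool (b : Bool)
  | int (i : ℤ)
  | add (e₁ e₂ : Expr)
  | sub (e₁ e₂ : Expr)
  | lt (e₁ e₂ : Expr)
  | eq (e₁ e₂ : Expr)
  | ite (e e₁ e₂ : Expr)
  | field (e : Expr) (f : FieldName)
  | ghost (e : Expr) (g : GhostName) {n : ℕ} (args : Fin n → Expr)

abbrev Expr.var (x : Name) : Expr := .opd (.var x)
abbrev Expr.this : Expr := .opd .this

/-- `e.Mentions z`: the variable `z` occurs in `e`. -/
def Expr.Mentions (z : Opd) : Expr → Prop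
  | .opd z' => z = z'
  | .null => False
  | .bool _ => False
  | .int _ => False
  | .add e₁ e₂ => e₁.Mentions z ∨ e₂.Mentions z
  | .sub e₁ e₂ => e₁.Mentions z ∨ e₂.Mentions z
  | .lt e₁ e₂ => e₁.Mentions z ∨ e₂.Mentions z
  | .eq e₁ e₂ => e₁.Mentions z ∨ e₂.Mentions z
  | .ite e e₁ e₂ => e.Mentions z ∨ e₁.Mentions z ∨ e₂.Mentions z
  | .field e _ => e.Mentions z
  | .ghost e _ args => e.Mentions z ∨ ∃ i, (args i).Mentions z

/-- Expressions that do not look into the heap. -/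
def Expr.Local : Expr → Prop
  | .opd _ => True
  | .null => True
  | .bool _ => True
  | .int _ => True
  | .add e₁ e₂ => e₁.Local ∧ e₂.Local
  | .sub e₁ e₂ => e₁.Local ∧ e₂.Local
  | .lt e₁ e₂ => e₁.Local ∧ e₂.Local
  | .eq e₁ e₂ => e₁.Local ∧ e₂.Local
  | .ite e e₁ e₂ => e.Local ∧ e₁.Local ∧ e₂.Local
  | .field _ _ => False
  | .ghost _ _ _ => False

/-- `e.rename x y` is `[y / x] e`. -/
def Expr.rename (x y : Name) : Expr → Expr
  | .opd .this => .opd .this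
  | .opd (.var z) => .opd (.var (if z = x then y else z))
  | .null => .null
  | .bool b => .bool b
  | .int i => .int i
  | .add e₁ e₂ => .add (e₁.rename x y) (e₂.rename x y)
  | .sub e₁ e₂ => .sub (e₁.rename x y) (e₂.rename x y)
  | .lt e₁ e₂ => .lt (e₁.rename x y) (e₂.rename x y)
  | .eq e₁ e₂ => .eq (e₁.rename x y) (e₂.rename x y)
  | .ite e e₁ e₂ => .ite (e.rename x y) (e₁.rename x y) (e₂.rename x y)
  | .field e f => .field (e.rename x y) f
  | .ghost e g args => .ghost (e.rename x y) g (fun i => (args i).rename x y)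

/-- Statements. -/
inductive Stmt
  | skip
  | assign (x : Name) (e : Expr)
  | read (x : Name) (u : Opd) (f : FieldName)
  | write (u : Opd) (f : FieldName) (v : Opd)
  | call (x : Name) (u : Opd) (m : MethName) (args : List Opd)
  | new (x : Name) (C : ClassName) (args : List Opd)
  | ret (u : Opd)
  | ite (e : Expr) (s₁ s₂ : Stmt)
  | seq (s₁ s₂ : Stmt)

/-- `s.Mentions z`: the variable `z` occurs in `s`. -/
def Stmt.Mentions (z : Opd) : Stmt → Prop
  | .skip => False
  | .assign x e => z = .var x ∨ e.Mentions z
  | .read x u _ => z = .var x ∨ z = u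
  | .write u _ v => z = u ∨ z = v
  | .call x u _ args => z = .var x ∨ z = u ∨ z ∈ args
  | .new x _ args => z = .var x ∨ z ∈ args
  | .ret u => z = u
  | .ite e s₁ s₂ => e.Mentions z ∨ s₁.Mentions z ∨ s₂.Mentions z
  | .seq s₁ s₂ => s₁.Mentions z ∨ s₂.Mentions z

structure MethDef where
  params : List (Name × Ty)
  body : List Stmt

structure GhostDef where
  params : List Name
  body : Expr

structure ClassDef where
  fields : List FieldName
  ctor : MethDef
  methods : MethName → Option MethDef
  ghosts : GhostName → Option GhostDef

/-- A module maps class names to class definitions. -/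
abbrev Module := ClassName → Option ClassDef

/-- `C ∈ dom(M)`. -/
def Module.Defines (M : Module) (C : ClassName) : Prop := (M C).isSome

def Module.Disjoint (M' M : Module) : Prop := ∀ C, ¬ (M'.Defines C ∧ M.Defines C)

/-- The linked module `M' ∘ M` (for disjoint modules). -/
def Module.link (M' M : Module) : Module := fun C => (M C).or (M' C)

/-! ## States and execution -/

/-- Partial maps from variable names to values. -/
abbrev Env := Name → Option Val

def Env.set (ρ : Env) (x : Name) (v : Val) : Env := Function.update ρ x (some v)

def Env.ofArgs : List Name → List Val → Env
  | x :: xs, v :: vs => (Env.ofArgs xs vs).set x v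
  | _, _ => fun _ => none

structure Obj where
  cls : ClassName
  flds : FieldName → Option Val

abbrev Heap := Addr → Option Obj

/-- The object at address `α` exists and has class `C`. -/
def Heap.HasClass (χ : Heap) (α : Addr) (C : ClassName) : Prop :=
  ∃ o, χ α = some o ∧ o.cls = C

def Heap.HasTy (χ : Heap) (v : Val) : Ty → Prop
  | .any => True
  | .bool => ∃ b, v = .bool b
  | .int => ∃ i, v = .int i
  | .cls C => v = .null ∨ ∃ α, v = .addr α ∧ χ.HasClass α C

/-- The values of `ρ` do not dangle in the heap `χ`. -/
def Env.Valid (ρ : Env) (χ : Heap) : Prop :=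
  ∀ x α, ρ x = some (.addr α) → (χ α).isSome

/-- Continuations: `run s` is code to be executed, `await x s` is `x := •; s`, where the frame
waits for the result of the call above it. -/
inductive Contn
  | run (s : List Stmt)
  | await (x : Name) (s : List Stmt)

/-- `κ.Mentions z`: the variable `z` occurs in `κ`. -/
def Contn.Mentions (z : Opd) : Contn → Prop
  | .run s => ∃ t ∈ s, t.Mentions z
  | .await x s => z = .var x ∨ ∃ t ∈ s, t.Mentions z

structure Frame where
  self : Addr
  vars : Env
  contn : Contn

def Frame.lookup (φ : Frame) : Opd → Option Val
  | .this => some (.addr φ.self)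
  | .var x => φ.vars x

/-- A state: a heap and a nonempty stack of frames, of which `top` is executing. -/
structure State where
  heap : Heap
  top : Frame
  rest : List Frame

def State.frames (σ : State) : List Frame := σ.top :: σ.rest

/-- `Eval M χ α ρ e v`: under module `M` and heap `χ`, with `this` denoting `α` and names looked up
in `ρ`, the expression `e` evaluates to `v`. -/
inductive Eval (M : Module) (χ : Heap) : Addr → Env → Expr → Val → Prop
  | this {α ρ} : Eval M χ α ρ (.opd .this) (.addr α)
  | var {α ρ x v} : ρ x = some v → Eval M χ α ρ (.opd (.var x)) v
  | null {α ρ} : Eval M χ α ρ .null .null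
  | bool {α ρ b} : Eval M χ α ρ (.bool b) (.bool b)
  | int {α ρ i} : Eval M χ α ρ (.int i) (.int i)
  | add {α ρ e₁ e₂ i j} : Eval M χ α ρ e₁ (.int i) → Eval M χ α ρ e₂ (.int j) →
      Eval M χ α ρ (.add e₁ e₂) (.int (i + j))
  | sub {α ρ e₁ e₂ i j} : Eval M χ α ρ e₁ (.int i) → Eval M χ α ρ e₂ (.int j) →
      Eval M χ α ρ (.sub e₁ e₂) (.int (i - j))
  | lt {α ρ e₁ e₂ i j} : Eval M χ α ρ e₁ (.int i) → Eval M χ α ρ e₂ (.int j) →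
      Eval M χ α ρ (.lt e₁ e₂) (.bool (decide (i < j)))
  | eq {α ρ e₁ e₂ v w} : Eval M χ α ρ e₁ v → Eval M χ α ρ e₂ w →
      Eval M χ α ρ (.eq e₁ e₂) (.bool (decide (v = w)))
  | ite_true {α ρ e e₁ e₂ v} : Eval M χ α ρ e (.bool true) → Eval M χ α ρ e₁ v →
      Eval M χ α ρ (.ite e e₁ e₂) v
  | ite_false {α ρ e e₁ e₂ v} : Eval M χ α ρ e (.bool false) → Eval M χ α ρ e₂ v →
      Eval M χ α ρ (.ite e e₁ e₂) v
  | field {α ρ e f β o v} : Eval M χ α ρ e (.addr β) → χ β = some o → o.flds f = some v →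
      Eval M χ α ρ (.field e f) v
  | ghost {α ρ e g β o cd gd v} {n : ℕ} {args : Fin n → Expr} {vs : Fin n → Val} :
      Eval M χ α ρ e (.addr β) → χ β = some o → M o.cls = some cd → cd.ghosts g = some gd →
      gd.params.length = n → (∀ i, Eval M χ α ρ (args i) (vs i)) →
      Eval M χ β (Env.ofArgs gd.params (List.ofFn vs)) gd.body v →
      Eval M χ α ρ (.ghost e g args) v

/-- The arguments `us` of a call or of an object creation in frame `φ` have the values `vs`, which
match the declared parameters `ps`. -/
def ArgsMatch (χ : Heap) (φ : Frame) (us : List Opd) (vs : List Val) (ps : List (Name × Ty)) :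
    Prop :=
  us.map φ.lookup = vs.map some ∧ List.Forall₂ (fun v p => χ.HasTy v p.2) vs ps

/-- Two objects have the same class: fields are private to a class. -/
def Heap.SameClass (χ : Heap) (α β : Addr) : Prop := ∃ C, χ.HasClass α C ∧ χ.HasClass β C

/-- Small-step execution of a (linked) module. -/
inductive Step (L : Module) : State → State → Prop
  | skip {χ α ρ s ψ} :
      Step L ⟨χ, ⟨α, ρ, .run (.skip :: s)⟩, ψ⟩ ⟨χ, ⟨α, ρ, .run s⟩, ψ⟩
  | seq {χ α ρ s₁ s₂ s ψ} :
      Step L ⟨χ, ⟨α, ρ, .run (.seq s₁ s₂ :: s)⟩, ψ⟩ ⟨χ, ⟨α, ρ, .run (s₁ :: s₂ :: s)⟩, ψ⟩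
  | ite_true {χ α ρ e s₁ s₂ s ψ} : e.Local → Eval L χ α ρ e (.bool true) →
      Step L ⟨χ, ⟨α, ρ, .run (.ite e s₁ s₂ :: s)⟩, ψ⟩ ⟨χ, ⟨α, ρ, .run (s₁ :: s)⟩, ψ⟩
  | ite_false {χ α ρ e s₁ s₂ s ψ} : e.Local → Eval L χ α ρ e (.bool false) →
      Step L ⟨χ, ⟨α, ρ, .run (.ite e s₁ s₂ :: s)⟩, ψ⟩ ⟨χ, ⟨α, ρ, .run (s₂ :: s)⟩, ψ⟩
  | assign {χ α ρ x e v s ψ} : e.Local → Eval L χ α ρ e v →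
      Step L ⟨χ, ⟨α, ρ, .run (.assign x e :: s)⟩, ψ⟩ ⟨χ, ⟨α, ρ.set x v, .run s⟩, ψ⟩
  | read {χ φ x u f β o v s ψ} : φ.contn = .run (.read x u f :: s) →
      φ.lookup u = some (.addr β) → χ.SameClass φ.self β →
      χ β = some o → o.flds f = some v →
      Step L ⟨χ, φ, ψ⟩ ⟨χ, ⟨φ.self, φ.vars.set x v, .run s⟩, ψ⟩
  | write {χ φ u f w β o v₀ v s ψ} : φ.contn = .run (.write u f w :: s) →
      φ.lookup u = some (.addr β) → χ.SameClass φ.self β →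
      χ β = some o → o.flds f = some v₀ → φ.lookup w = some v →
      Step L ⟨χ, φ, ψ⟩
        ⟨Function.update χ β (some { o with flds := Function.update o.flds f (some v) }),
          ⟨φ.self, φ.vars, .run s⟩, ψ⟩
  | call {χ φ x u m us β o cd md vs s ψ} : φ.contn = .run (.call x u m us :: s) →
      φ.lookup u = some (.addr β) → χ β = some o → L o.cls = some cd →
      cd.methods m = some md → ArgsMatch χ φ us vs md.params →
      Step L ⟨χ, φ, ψ⟩
        ⟨χ, ⟨β, Env.ofArgs (md.params.map Prod.fst) vs, .run md.body⟩,
          ⟨φ.self, φ.vars, .await x s⟩ :: ψ⟩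
  | new {χ φ x C us β cd vs s ψ} : φ.contn = .run (.new x C us :: s) →
      L C = some cd → χ β = none → ArgsMatch χ φ us vs cd.ctor.params →
      Step L ⟨χ, φ, ψ⟩
        ⟨Function.update χ β
            (some ⟨C, fun f => if f ∈ cd.fields then some .null else none⟩),
          ⟨β, Env.ofArgs (cd.ctor.params.map Prod.fst) vs, .run (cd.ctor.body ++ [.ret .this])⟩,
          ⟨φ.self, φ.vars, .await x s⟩ :: ψ⟩
  | ret {χ φ φ' u v x s s' ψ} : φ.contn = .run (.ret u :: s') → φ.lookup u = some v →
      φ'.contn = .await x s →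
      Step L ⟨χ, φ, φ' :: ψ⟩ ⟨χ, ⟨φ'.self, φ'.vars.set x v, .run s⟩, ψ⟩

/-- The executing object is internal, that is, its class is defined in `M`. -/
def State.Internal (M : Module) (σ : State) : Prop :=
  ∃ C, σ.heap.HasClass σ.top.self C ∧ M.Defines C

/-- The executing object is external. -/
def State.External (M : Module) (σ : State) : Prop :=
  ∃ C, σ.heap.HasClass σ.top.self C ∧ ¬ M.Defines C

/-- External states semantics `(M'; M, σ) ⇝ (M'; M, σ')`: at least one step of execution between two
external states, such that all states strictly in between are internal. -/
def ExtStep (M' M : Module) (σ σ' : State) : Prop :=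
  σ.External M ∧ σ'.External M ∧
    ∃ τ, Relation.ReflTransGen
        (fun τ₁ τ₂ => Step (M'.link M) τ₁ τ₂ ∧ τ₂.Internal M) σ τ ∧
      Step (M'.link M) τ σ'

/-- The name of the class `Object`. -/
def objectClass : ClassName := 0

/-- Initial states: one frame, whose only variable is `this`, and which is about to execute arbitrary
code; one object, of class `Object` and without fields. -/
def State.Initial (σ : State) : Prop :=
  ∃ (α : Addr) (s : List Stmt),
    σ = ⟨Function.update (fun _ => none) α (some ⟨objectClass, fun _ => none⟩),
          ⟨α, fun _ => none, .run s⟩, []⟩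

/-- `σ` arises from external states execution of `M` with the external module `M'`. -/
def Arising (M' M : Module) (σ : State) : Prop :=
  ∃ σ₀, σ₀.Initial ∧ Relation.ReflTransGen (ExtStep M' M) σ₀ σ

/-- The standing restriction on internal modules: whatever external module `M` is linked with, code
executing on an internal object calls methods of internal objects only, and creates objects of
internal classes only. -/
def Module.Isolated (M : Module) : Prop :=
  ∀ M' : Module, M'.Disjoint M → ∀ σ₀ σ : State, σ₀.Initial →
    Relation.ReflTransGen (Step (M'.link M)) σ₀ σ → σ.Internal M →
      (∀ x u m us s, σ.top.contn = .run (.call x u m us :: s) →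
        ∀ β o, σ.top.lookup u = some (.addr β) → σ.heap β = some o → M.Defines o.cls) ∧
      (∀ x C us s, σ.top.contn = .run (.new x C us :: s) → M.Defines C)

/-! ## Assertions -/

/-- Assertions. In `calls c e m args` the caller `none` is the wildcard `_`. -/
inductive Asrt
  | expr (e : Expr)
  | hasClass (e : Expr) (C : ClassName)
  | not (A : Asrt)
  | and (A B : Asrt)
  | or (A B : Asrt)
  | imp (A B : Asrt)
  | all (x : Name) (A : Asrt)
  | ex (x : Name) (A : Asrt)
  | access (e₁ e₂ : Expr)
  | internal (e : Expr)
  | external (e : Expr)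
  | calls (caller : Option Expr) (e : Expr) (m : MethName) (args : List Expr)

/-- The variable `x` occurs free in the assertion. -/
def Asrt.Free (x : Name) : Asrt → Prop
  | .expr e => e.Mentions (.var x)
  | .hasClass e _ => e.Mentions (.var x)
  | .not A => A.Free x
  | .and A B => A.Free x ∨ B.Free x
  | .or A B => A.Free x ∨ B.Free x
  | .imp A B => A.Free x ∨ B.Free x
  | .all y A => x ≠ y ∧ A.Free x
  | .ex y A => x ≠ y ∧ A.Free x
  | .access e₁ e₂ => e₁.Mentions (.var x) ∨ e₂.Mentions (.var x)
  | .internal e => e.Mentions (.var x)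
  | .external e => e.Mentions (.var x)
  | .calls c e _ args =>
      (∃ e' ∈ c, e'.Mentions (.var x)) ∨ e.Mentions (.var x) ∨ ∃ e' ∈ args, e'.Mentions (.var x)

/-- The variable `x` is bound by some quantifier in the assertion. -/
def Asrt.Binds (x : Name) : Asrt → Prop
  | .not A => A.Binds x
  | .and A B => A.Binds x ∨ B.Binds x
  | .or A B => A.Binds x ∨ B.Binds x
  | .imp A B => A.Binds x ∨ B.Binds x
  | .all y A => x = y ∨ A.Binds x
  | .ex y A => x = y ∨ A.Binds x
  | _ => False

/-- `A.rename x y` is `[y / x] A`, for `y` that is not bound in `A` (so that no capture occurs). -/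
def Asrt.rename (x y : Name) : Asrt → Asrt
  | .expr e => .expr (e.rename x y)
  | .hasClass e C => .hasClass (e.rename x y) C
  | .not A => .not (A.rename x y)
  | .and A B => .and (A.rename x y) (B.rename x y)
  | .or A B => .or (A.rename x y) (B.rename x y)
  | .imp A B => .imp (A.rename x y) (B.rename x y)
  | .all z A => if z = x then .all z A else .all z (A.rename x y)
  | .ex z A => if z = x then .ex z A else .ex z (A.rename x y)
  | .access e₁ e₂ => .access (e₁.rename x y) (e₂.rename x y)
  | .internal e => .internal (e.rename x y)
  | .external e => .external (e.rename x y)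
  | .calls c e m args =>
      .calls (c.map (Expr.rename x y)) (e.rename x y) m (args.map (Expr.rename x y))

/-- Classical assertions. -/
def Asrt.Classical : Asrt → Prop
  | .expr _ => True
  | .hasClass _ _ => True
  | .not A => A.Classical
  | .and A B => A.Classical ∧ B.Classical
  | .or A B => A.Classical ∧ B.Classical
  | .imp A B => A.Classical ∧ B.Classical
  | .all _ A => A.Classical
  | .ex _ A => A.Classical
  | _ => False

/-- The assertion `false`. -/
def Asrt.false : Asrt := .expr (.bool Bool.false)

/-- `inside(y)`: only internal objects have access to `y`. The bound variable differs from `y`. -/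
def Asrt.inside (y : Name) : Asrt :=
  .all (y + 1) (.imp (.access (.var (y + 1)) (.var y)) (.internal (.var (y + 1))))

/-- Value of an assertion's expression in `σ`, with names looked up in `ρ`. -/
def State.Eval (M : Module) (σ : State) (ρ : Env) (e : Expr) (v : Val) : Prop :=
  Necessity.Eval M σ.heap σ.top.self ρ e v

/-- `α` has access to `v`: through a field, or through a variable (of a frame in which `α` executes)
that occurs in the frame's continuation. -/
def State.Access (σ : State) (α : Addr) (v : Val) : Prop :=
  (∃ o f, σ.heap α = some o ∧ o.flds f = some v) ∨
  (∃ φ ∈ σ.frames, φ.self = α ∧ ∃ z, φ.contn.Mentions z ∧ φ.lookup z = some v)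

/-- Satisfaction `M, σ ⊨ A`, where the variables of `A` are looked up in the variable map `ρ`. With
`ρ` taken over from an earlier state `σ₀` this is satisfaction in the adapted state `σ ◁ σ₀`. -/
def Sat (M : Module) (σ : State) : Env → Asrt → Prop
  | ρ, .expr e => σ.Eval M ρ e (.bool true)
  | ρ, .hasClass e C => ∃ α, σ.Eval M ρ e (.addr α) ∧ σ.heap.HasClass α C
  | ρ, .not A => ¬ Sat M σ ρ A
  | ρ, .and A B => Sat M σ ρ A ∧ Sat M σ ρ B
  | ρ, .or A B => Sat M σ ρ A ∨ Sat M σ ρ B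
  | ρ, .imp A B => Sat M σ ρ A → Sat M σ ρ B
  | ρ, .all x A => ∀ α, (σ.heap α).isSome → Sat M σ (ρ.set x (.addr α)) A
  | ρ, .ex x A => ∃ α, (σ.heap α).isSome ∧ Sat M σ (ρ.set x (.addr α)) A
  | ρ, .access e₁ e₂ =>
      ∃ α v, σ.Eval M ρ e₁ (.addr α) ∧ σ.Eval M ρ e₂ v ∧ σ.Access α v
  | ρ, .internal e =>
      ∃ α C, σ.Eval M ρ e (.addr α) ∧ σ.heap.HasClass α C ∧ M.Defines C
  | ρ, .external e =>
      ∃ α C, σ.Eval M ρ e (.addr α) ∧ σ.heap.HasClass α C ∧ ¬ M.Defines C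
  | ρ, .calls c e m args =>
      (∀ e' ∈ c, σ.Eval M ρ e' (.addr σ.top.self)) ∧
      ∃ x u us s, σ.top.contn = .run (.call x u m us :: s) ∧
        (∃ α, σ.Eval M ρ e (.addr α) ∧ σ.top.lookup u = some (.addr α)) ∧
        List.Forall₂ (fun e' u' => ∃ v, σ.Eval M ρ e' v ∧ σ.top.lookup u' = some v) args us

/-- `M ⊨ A`. -/
def ValidAsrt (M : Module) (A : Asrt) : Prop :=
  ∀ M' : Module, M'.Disjoint M → ∀ (σ : State) (ρ : Env), Arising M' M σ → ρ.Valid σ.heap →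
    Sat M σ ρ A

/-- `M ⊨ A' ⇒ Enc(A)`: assertion encapsulation. -/
def ValidEnc (M : Module) (A' A : Asrt) : Prop :=
  ∀ M' : Module, M'.Disjoint M → ∀ (σ σ' : State) (ρ : Env), Arising M' M σ → ρ.Valid σ.heap →
    ExtStep M' M σ σ' → Sat M σ ρ (.and A A') → Sat M σ' ρ (.not A) →
      ∃ (ρ' : Env) (x : Name) (m : MethName) (zs : List Name), ρ'.Valid σ.heap ∧
        Sat M σ ρ' (.and (.calls none (.var x) m (zs.map .var)) (.internal (.var x)))

/-! ## Hoare triples for method calls -/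

/-- The variable that denotes the result of the call in postconditions. -/
def res : Name := 0

/-- Execution of `L` from `σ`, whose next statement is a method call with result variable `w`,
completes this call and reaches `σ'`: all states in between have frames above the caller's. -/
def CallCompletes (L : Module) (σ : State) (w : Name) (σ' : State) : Prop :=
  (∃ u m us s, σ.top.contn = .run (.call w u m us :: s)) ∧
  (∃ τ, Relation.ReflTransGen
      (fun τ₁ τ₂ => Step L τ₁ τ₂ ∧ σ.rest.length < τ₂.rest.length) σ τ ∧
    Step L τ σ' ∧ σ'.rest.length = σ.rest.length)

/-- `M ⊨ {P} res = x.m(zs) {Q}`: in every program state that satisfies `P` and is about to execute the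
call, if the execution of the call completes then `Q` holds, with the returned value for `res`. -/
def ValidTriple (M : Module) (P : Asrt) (x : Name) (m : MethName) (zs : List Name) (Q : Asrt) :
    Prop :=
  ∀ M' : Module, M'.Disjoint M → ∀ (σ σ' : State) (ρ : Env) (w : Name) (v : Val),
    ρ.Valid σ.heap → Sat M σ ρ P → Sat M σ ρ (.calls none (.var x) m (zs.map .var)) →
    CallCompletes (M'.link M) σ w σ' → σ'.top.vars w = some v → Sat M σ' (ρ.set res v) Q

/-! ## Necessity specifications -/

/-- `onlyIf1 A₁ A₂ A` is `from A₁ to1 A₂ onlyIf A`, `onlyIf A₁ A₂ A` is `from A₁ to A₂ onlyIf A`, and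
`onlyThrough A₁ A₂ A` is `from A₁ to A₂ onlyThrough A`. -/
inductive Spec
  | onlyIf1 (A₁ A₂ A : Asrt)
  | onlyIf (A₁ A₂ A : Asrt)
  | onlyThrough (A₁ A₂ A : Asrt)

/-- `M ⊨ S`. The same `ρ` is used in all states: later states are adapted to the first one. -/
def ValidSpec (M : Module) : Spec → Prop
  | .onlyIf1 A₁ A₂ A =>
      ∀ M' : Module, M'.Disjoint M → ∀ (σ σ' : State) (ρ : Env), Arising M' M σ →
        ρ.Valid σ.heap → Sat M σ ρ A₁ → Sat M σ' ρ A₂ → ExtStep M' M σ σ' → Sat M σ ρ A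
  | .onlyIf A₁ A₂ A =>
      ∀ M' : Module, M'.Disjoint M → ∀ (σ σ' : State) (ρ : Env), Arising M' M σ →
        ρ.Valid σ.heap → Sat M σ ρ A₁ → Sat M σ' ρ A₂ →
        Relation.ReflTransGen (ExtStep M' M) σ σ' → Sat M σ ρ A
  | .onlyThrough A₁ A₂ A =>
      ∀ M' : Module, M'.Disjoint M → ∀ (n : ℕ) (σ : ℕ → State) (ρ : Env), Arising M' M (σ 0) →
        ρ.Valid (σ 0).heap → Sat M (σ 0) ρ A₁ → Sat M (σ n) ρ A₂ →
        (∀ i < n, ExtStep M' M (σ i) (σ (i + 1))) → ∃ i ≤ n, Sat M (σ i) ρ A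

/-! ## The logic -/

/-- The judgments on which the logic is built: `M ⊢ A`, `M ⊢ A' ⇒ Enc(A)` and
`M ⊢ {P} res = x.m(zs) {Q}`. -/
structure BaseSystems where
  asrt : Module → Asrt → Prop
  enc : Module → Asrt → Asrt → Prop
  triple : Module → Asrt → Name → MethName → List Name → Asrt → Prop

def BaseSystems.AsrtSound (B : BaseSystems) : Prop :=
  ∀ M : Module, M.Isolated → ∀ A, B.asrt M A → ValidAsrt M A

def BaseSystems.EncSound (B : BaseSystems) : Prop :=
  ∀ M : Module, M.Isolated → ∀ A' A, B.enc M A' A → ValidEnc M A' A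

def BaseSystems.TripleSound (B : BaseSystems) : Prop :=
  ∀ M : Module, M.Isolated → ∀ P x m zs Q, P.Classical → Q.Classical →
    B.triple M P x m zs Q → ValidTriple M P x m zs Q

/-- `A ∧ x : C ∧ ⟨_ calls x.m(zs)⟩`. -/
def Asrt.andCall (A : Asrt) (x : Name) (C : ClassName) (m : MethName) (zs : List Name) : Asrt :=
  .and A (.and (.hasClass (.var x) C) (.calls none (.var x) m (zs.map .var)))

/-- Derivability `M ⊢ S` of Necessity specifications. -/
inductive Proves (B : BaseSystems) (M : Module) : Spec → Prop
  | if1_classical {P₁ P₂ P : Asrt} {x : Name} {C : ClassName} {m : MethName} {zs : List Name} :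
      M.Defines C → P₁.Classical → P₂.Classical → P.Classical → ¬ P₂.Free res →
      B.triple M (.and (.hasClass (.var x) C) (.and P₁ (.not P))) x m zs (.not P₂) →
      Proves B M (.onlyIf1 (P₁.andCall x C m zs) P₂ P)
  | if1_inside {P : Asrt} {x y : Name} {C : ClassName} {m : MethName} {zs : List Name} :
      M.Defines C → P.Classical →
      B.triple M (.and (.hasClass (.var x) C) (.not P)) x m zs
        (.not (.expr (.eq (.var res) (.var y)))) →
      Proves B M (.onlyIf1 ((Asrt.inside y).andCall x C m zs) (.not (Asrt.inside y)) P)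
  /-- `x` and the arguments `zs C m` are distinct fresh variables. -/
  | if1_internal {A₁ A₂ A₃ : Asrt} {x : Name} {zs : ClassName → MethName → List Name} :
      (∀ C m, (x :: zs C m).Nodup) →
      (∀ C m, ∀ z ∈ x :: zs C m, ¬ A₁.Free z ∧ ¬ A₂.Free z ∧ ¬ A₃.Free z) →
      (∀ C cd m md, M C = some cd → cd.methods m = some md →
        (zs C m).length = md.params.length) →
      (∀ C cd m md, M C = some cd → cd.methods m = some md →
        Proves B M (.onlyIf1 (A₁.andCall x C m (zs C m)) A₂ A₃)) →
      B.asrt M (.imp A₁ (.not A₂)) →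
      B.enc M A₁ (.not A₂) →
      Proves B M (.onlyIf1 A₁ A₂ A₃)
  | if1_imp {A₁ A₂ A₃ A₁' A₂' A₃' : Asrt} :
      B.asrt M (.imp A₁ A₁') → B.asrt M (.imp A₂ A₂') → B.asrt M (.imp A₃' A₃) →
      Proves B M (.onlyIf1 A₁' A₂' A₃') → Proves B M (.onlyIf1 A₁ A₂ A₃)
  | if1_orE {A₁ A₂ A A' : Asrt} :
      Proves B M (.onlyIf1 A₁ A₂ (.or A A')) → Proves B M (.onlyThrough A' A₂ Asrt.false) →
      Proves B M (.onlyIf1 A₁ A₂ A)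
  | if1_ex₁ {A₁ A₂ A : Asrt} {x : Name} :
      (∀ y, ¬ A₁.Binds y → Proves B M (.onlyIf1 (A₁.rename x y) A₂ A)) →
      Proves B M (.onlyIf1 (.ex x A₁) A₂ A)
  | changes {A A' : Asrt} :
      Proves B M (.onlyIf1 A (.not A) A') → Proves B M (.onlyThrough A (.not A) A')
  | trans₁ {A₁ A₂ A₃ A : Asrt} :
      Proves B M (.onlyThrough A₁ A₂ A₃) → Proves B M (.onlyThrough A₁ A₃ A) →
      Proves B M (.onlyThrough A₁ A₂ A)
  | trans₂ {A₁ A₂ A₃ A : Asrt} :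
      Proves B M (.onlyThrough A₁ A₂ A₃) → Proves B M (.onlyThrough A₃ A₂ A) →
      Proves B M (.onlyThrough A₁ A₂ A)
  | if_ {A₁ A₂ A : Asrt} :
      Proves B M (.onlyIf A₁ A₂ A) → Proves B M (.onlyThrough A₁ A₂ A)
  | end_ {A₁ A₂ : Asrt} : Proves B M (.onlyThrough A₁ A₂ A₂)
  | if_trans {A₁ A₂ A₃ A : Asrt} :
      Proves B M (.onlyThrough A₁ A₂ A₃) → Proves B M (.onlyIf A₁ A₃ A) →
      Proves B M (.onlyIf A₁ A₂ A)
  | if_class {x : Name} {C : ClassName} :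
      Proves B M (.onlyIf (.hasClass (.var x) C) (.not (.hasClass (.var x) C)) Asrt.false)
  | if_start {A₁ A₂ : Asrt} : Proves B M (.onlyIf A₁ A₂ A₁)

end Necessity

/-!
Soundness is proved by induction on the derivation. For most rules the conclusion is immediate from
the semantics of paths of external steps; three points carry the weight.

* **Rules about calls.** Suppose an external state `σ` calls a method of an internal object and
  `σ'` is the next external state. As long as execution has not come back to the caller, every frame
  above the caller's runs on an internal object; since `M` is isolated, such code cannot hand control
  to an external object by a call or a creation, so the only way to reach the external state `σ'` is
  to return to the caller. Hence the external step is exactly the completed call, and the Hoare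
  triple applies to it. Moreover such code cannot change external objects, fields being private to a
  class, and creates none. This is `ExtStep.completes_call`. For `If1-Inside` it shows that an external
  object can have gained access only through the returned value, which the triple says is not `y`.

* **Rule If1-Internal.** Encapsulation yields an internal call in the first state, but expressed by
  variables of its own. The variables `x, zs` of the premises are fresh, so they may be
  set to the receiver and the arguments of that call without affecting the assertions
  (`sat_congr`); the premise for the class and method of the call then applies.

* **Rule If1-∃₁.** The witness is stored in a variable that is neither free nor bound in the
  assertions. Such a variable exists by finiteness, and the renaming is justified by `sat_rename`.
-/

namespace Necessity

/-! ### Evaluation and satisfaction under a change of the variable map -/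

section Congruence

variable {M : Module} {χ : Heap} {α : Addr} {ρ ρ' : Env}

/-- Evaluation of a renamed expression: `ρ'` at the new names is `ρ` at the old ones. -/
theorem eval_rename {x y : Name} {e : Expr}
    (h : ∀ z, e.Mentions (.var z) → ρ z = ρ' (if z = x then y else z)) {v : Val} :
    Eval M χ α ρ e v ↔ Eval M χ α ρ' (e.rename x y) v := by
  induction e generalizing v with
  | opd z =>
    cases z with
    | this =>
      constructor <;> intro h' <;> cases h' <;> exact .this
    | var z =>
      have hz := h z rfl
      constructor
      · rintro (_ | h')
        exact .var (hz ▸ h')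
      · rintro (_ | h')
        exact .var (hz.trans h')
  | null => constructor <;> intro h' <;> cases h' <;> exact .null
  | bool b => constructor <;> intro h' <;> cases h' <;> exact .bool
  | int i => constructor <;> intro h' <;> cases h' <;> exact .int
  | add e₁ e₂ ih₁ ih₂ =>
    have ih₁ := @ih₁ fun z hz => h z (.inl hz)
    have ih₂ := @ih₂ fun z hz => h z (.inr hz)
    constructor <;> intro h' <;> cases h' with | add h₁ h₂ => ?_
    · exact .add (ih₁.1 h₁) (ih₂.1 h₂)
    · exact .add (ih₁.2 h₁) (ih₂.2 h₂)
  | sub e₁ e₂ ih₁ ih₂ =>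
    have ih₁ := @ih₁ fun z hz => h z (.inl hz)
    have ih₂ := @ih₂ fun z hz => h z (.inr hz)
    constructor <;> intro h' <;> cases h' with | sub h₁ h₂ => ?_
    · exact .sub (ih₁.1 h₁) (ih₂.1 h₂)
    · exact .sub (ih₁.2 h₁) (ih₂.2 h₂)
  | lt e₁ e₂ ih₁ ih₂ =>
    have ih₁ := @ih₁ fun z hz => h z (.inl hz)
    have ih₂ := @ih₂ fun z hz => h z (.inr hz)
    constructor <;> intro h' <;> cases h' with | lt h₁ h₂ => ?_
    · exact .lt (ih₁.1 h₁) (ih₂.1 h₂)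
    · exact .lt (ih₁.2 h₁) (ih₂.2 h₂)
  | eq e₁ e₂ ih₁ ih₂ =>
    have ih₁ := @ih₁ fun z hz => h z (.inl hz)
    have ih₂ := @ih₂ fun z hz => h z (.inr hz)
    constructor <;> intro h' <;> cases h' with | eq h₁ h₂ => ?_
    · exact .eq (ih₁.1 h₁) (ih₂.1 h₂)
    · exact .eq (ih₁.2 h₁) (ih₂.2 h₂)
  | ite e e₁ e₂ ih ih₁ ih₂ =>
    have ih := @ih fun z hz => h z (.inl hz)
    have ih₁ := @ih₁ fun z hz => h z (.inr (.inl hz))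
    have ih₂ := @ih₂ fun z hz => h z (.inr (.inr hz))
    constructor <;> intro h' <;> cases h' with
      | ite_true h₁ h₂ => ?_
      | ite_false h₁ h₂ => ?_
    · exact .ite_true (ih.1 h₁) (ih₁.1 h₂)
    · exact .ite_false (ih.1 h₁) (ih₂.1 h₂)
    · exact .ite_true (ih.2 h₁) (ih₁.2 h₂)
    · exact .ite_false (ih.2 h₁) (ih₂.2 h₂)
  | field e f ih =>
    have ih := @ih h
    constructor <;> intro h' <;> cases h' with | field h₁ h₂ h₃ => ?_
    · exact .field (ih.1 h₁) h₂ h₃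
    · exact .field (ih.2 h₁) h₂ h₃
  | ghost e g args ih iha =>
    have ih := @ih fun z hz => h z (.inl hz)
    have iha := fun i => @iha i fun z hz => h z (.inr ⟨i, hz⟩)
    constructor <;> intro h' <;> cases h' with | ghost h₁ h₂ h₃ h₄ h₅ h₆ h₇ => ?_
    · exact .ghost (ih.1 h₁) h₂ h₃ h₄ h₅ (fun i => (iha i).1 (h₆ i)) h₇
    · exact .ghost (ih.2 h₁) h₂ h₃ h₄ h₅ (fun i => (iha i).2 (h₆ i)) h₇

theorem Expr.rename_self (x : Name) (e : Expr) : e.rename x x = e := by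
  induction e with
  | opd z => cases z <;> simp +contextual [Expr.rename]
  | _ => simp_all [Expr.rename]

theorem eval_congr {e : Expr} (h : ∀ z, e.Mentions (.var z) → ρ z = ρ' z) {v : Val} :
    Eval M χ α ρ e v ↔ Eval M χ α ρ' e v := by
  have := @eval_rename M χ α ρ ρ' 0 0 e (fun z hz => by
    rw [h z hz]; split <;> simp_all) v
  rwa [Expr.rename_self] at this

theorem eval_var {x : Name} {v : Val} : Eval M χ α ρ (.var x) v ↔ ρ x = some v :=
  ⟨by rintro (_ | h); exact h, .var⟩

end Congruence

theorem Env.set_self (ρ : Env) (x : Name) (v : Val) : ρ.set x v x = some v := by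
  simp [Env.set]

theorem Env.set_of_ne (ρ : Env) {x z : Name} (v : Val) (h : z ≠ x) : ρ.set x v z = ρ z := by
  simp [Env.set, h]

theorem Env.Valid.set {ρ : Env} {χ : Heap} (h : ρ.Valid χ) (x : Name) {α : Addr}
    (hα : (χ α).isSome) : (ρ.set x (.addr α)).Valid χ := by
  intro z β hz
  by_cases hzx : z = x
  · subst hzx
    rw [Env.set_self] at hz
    cases hz
    exact hα
  · rw [Env.set_of_ne _ _ hzx] at hz
    exact h z β hz

theorem Env.set_congr {ρ ρ' : Env} {x z : Name} (v : Val) (h : z ≠ x → ρ z = ρ' z) :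
    ρ.set x v z = ρ'.set x v z := by
  by_cases hzx : z = x
  · subst hzx; simp only [Env.set_self]
  · rw [Env.set_of_ne _ _ hzx, Env.set_of_ne _ _ hzx, h hzx]

theorem forall₂_congr_of_mem {α β : Type*} {R S : α → β → Prop} {l : List α} {l' : List β}
    (h : ∀ a ∈ l, ∀ b, R a b ↔ S a b) : List.Forall₂ R l l' ↔ List.Forall₂ S l l' := by
  induction l generalizing l' with
  | nil => cases l' <;> simp
  | cons a l ih =>
    cases l' with
    | nil => simp
    | cons b l' =>
      rw [List.forall₂_cons, List.forall₂_cons, h a (by simp),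
        ih fun c hc => h c (List.mem_cons_of_mem a hc)]

theorem sat_congr {M : Module} {σ : State} {A : Asrt} {ρ ρ' : Env}
    (h : ∀ z, A.Free z → ρ z = ρ' z) : Sat M σ ρ A ↔ Sat M σ ρ' A := by
  induction A generalizing ρ ρ' with
  | expr e => exact eval_congr h
  | hasClass e C => exact exists_congr fun α => and_congr_left' (eval_congr h)
  | not A ih => exact not_congr (ih h)
  | and A B ihA ihB =>
    exact and_congr (ihA fun z hz => h z (.inl hz)) (ihB fun z hz => h z (.inr hz))
  | or A B ihA ihB =>
    exact or_congr (ihA fun z hz => h z (.inl hz)) (ihB fun z hz => h z (.inr hz))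
  | imp A B ihA ihB =>
    exact imp_congr (ihA fun z hz => h z (.inl hz)) (ihB fun z hz => h z (.inr hz))
  | all x A ih =>
    exact forall_congr' fun α => imp_congr_right fun _ =>
      ih fun z hz => Env.set_congr _ fun hzx => h z ⟨hzx, hz⟩
  | ex x A ih =>
    exact exists_congr fun α => and_congr_right' <|
      ih fun z hz => Env.set_congr _ fun hzx => h z ⟨hzx, hz⟩
  | access e₁ e₂ =>
    exact exists_congr fun α => exists_congr fun v => and_congr
      (eval_congr fun z hz => h z (.inl hz))
      (and_congr_left' (eval_congr fun z hz => h z (.inr hz)))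
  | internal e =>
    exact exists_congr fun α => exists_congr fun C => and_congr_left' (eval_congr h)
  | external e =>
    exact exists_congr fun α => exists_congr fun C => and_congr_left' (eval_congr h)
  | calls c e m args =>
    refine and_congr (forall₂_congr fun e' he' => eval_congr fun z hz => h z (.inl ⟨e', he', hz⟩))
      (exists_congr fun x => exists_congr fun u => exists_congr fun us => exists_congr fun s =>
        and_congr_right' (and_congr (exists_congr fun α => and_congr_left' <|
          eval_congr fun z hz => h z (.inr (.inl hz))) ?_))
    exact forall₂_congr_of_mem fun e' he' b => exists_congr fun v => and_congr_left' <|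
      eval_congr fun z hz => h z (.inr (.inr ⟨e', he', hz⟩))

/-- Satisfaction of a renamed assertion: `ρ'` at the new names is `ρ` at the old ones. -/
theorem sat_rename {M : Module} {σ : State} {A : Asrt} {ρ ρ' : Env} {x y : Name}
    (hy : ¬ A.Binds y) (h : ∀ z, A.Free z → ρ z = ρ' (if z = x then y else z)) :
    Sat M σ ρ A ↔ Sat M σ ρ' (A.rename x y) := by
  -- The bound variable of a quantifier is `x` itself, and nothing is renamed below it, or it
  -- differs from both `x` and `y`.
  have quant : ∀ {w : Name} {B : Asrt} (v : Val), w ≠ y → w ≠ x → ∀ {ρ ρ' : Env},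
      (∀ z, z ≠ w ∧ B.Free z → ρ z = ρ' (if z = x then y else z)) →
      ∀ z, B.Free z → ρ.set w v z = ρ'.set w v (if z = x then y else z) := by
    intro w B v hwy hwx ρ ρ' h z hz
    by_cases hzw : z = w
    · subst hzw; rw [if_neg hwx, Env.set_self, Env.set_self]
    · rw [Env.set_of_ne _ _ hzw, h z ⟨hzw, hz⟩, Env.set_of_ne]
      split
      · exact hwy.symm
      · exact hzw
  have same : ∀ {B : Asrt} (v : Val) {ρ ρ' : Env},
      (∀ z, z ≠ x ∧ B.Free z → ρ z = ρ' (if z = x then y else z)) →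
      ∀ z, B.Free z → ρ.set x v z = ρ'.set x v z := by
    intro B v ρ ρ' h z hz
    refine Env.set_congr v fun hzx => ?_
    rw [h z ⟨hzx, hz⟩, if_neg hzx]
  induction A generalizing ρ ρ' with
  | expr e => exact eval_rename h
  | hasClass e C => exact exists_congr fun α => and_congr_left' (eval_rename h)
  | not A ih => exact not_congr (ih hy h)
  | and A B ihA ihB =>
    exact and_congr (ihA (fun hb => hy (.inl hb)) fun z hz => h z (.inl hz))
      (ihB (fun hb => hy (.inr hb)) fun z hz => h z (.inr hz))
  | or A B ihA ihB =>
    exact or_congr (ihA (fun hb => hy (.inl hb)) fun z hz => h z (.inl hz))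
      (ihB (fun hb => hy (.inr hb)) fun z hz => h z (.inr hz))
  | imp A B ihA ihB =>
    exact imp_congr (ihA (fun hb => hy (.inl hb)) fun z hz => h z (.inl hz))
      (ihB (fun hb => hy (.inr hb)) fun z hz => h z (.inr hz))
  | all w A ih =>
    rw [Asrt.rename]
    split
    · subst w
      exact forall_congr' fun α => imp_congr_right fun _ => sat_congr (same _ h)
    · next hwx =>
      exact forall_congr' fun α => imp_congr_right fun _ =>
        ih (fun hb => hy (.inr hb)) (quant _ (fun e => hy (.inl e.symm)) hwx h)
  | ex w A ih =>
    rw [Asrt.rename]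
    split
    · subst w
      exact exists_congr fun α => and_congr_right' <| sat_congr (same _ h)
    · next hwx =>
      exact exists_congr fun α => and_congr_right' <|
        ih (fun hb => hy (.inr hb)) (quant _ (fun e => hy (.inl e.symm)) hwx h)
  | access e₁ e₂ =>
    exact exists_congr fun α => exists_congr fun v => and_congr
      (eval_rename fun z hz => h z (.inl hz))
      (and_congr_left' (eval_rename fun z hz => h z (.inr hz)))
  | internal e =>
    exact exists_congr fun α => exists_congr fun C => and_congr_left' (eval_rename h)
  | external e =>
    exact exists_congr fun α => exists_congr fun C => and_congr_left' (eval_rename h)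
  | calls c e m args =>
    refine and_congr ?_
      (exists_congr fun x => exists_congr fun u => exists_congr fun us => exists_congr fun s =>
        and_congr_right' (and_congr (exists_congr fun α => and_congr_left' <|
          eval_rename fun z hz => h z (.inr (.inl hz))) ?_))
    · cases c with
      | none => simp
      | some e' =>
        simp only [Option.map_some, Option.mem_def, Option.some.injEq, forall_eq']
        exact eval_rename fun z hz => h z (.inl ⟨e', rfl, hz⟩)
    · rw [List.forall₂_map_left_iff]
      exact forall₂_congr_of_mem fun e' he' b => exists_congr fun v => and_congr_left' <|
        eval_rename fun z hz => h z (.inr (.inr ⟨e', he', hz⟩))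

/-! ### Fresh variables -/

theorem Expr.finite_mentions (e : Expr) : {x : Name | e.Mentions (.var x)}.Finite := by
  induction e with
  | opd z =>
    refine Set.Subsingleton.finite fun x hx y hy => ?_
    exact Opd.var.inj ((hx : Opd.var x = z).trans (hy : Opd.var y = z).symm)
  | null => exact Set.finite_empty
  | bool b => exact Set.finite_empty
  | int i => exact Set.finite_empty
  | add e₁ e₂ ih₁ ih₂ => exact ih₁.union ih₂
  | sub e₁ e₂ ih₁ ih₂ => exact ih₁.union ih₂
  | lt e₁ e₂ ih₁ ih₂ => exact ih₁.union ih₂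
  | eq e₁ e₂ ih₁ ih₂ => exact ih₁.union ih₂
  | ite e e₁ e₂ ih ih₁ ih₂ => exact ih.union (ih₁.union ih₂)
  | field e f ih => exact ih
  | ghost e g args ih iha =>
    refine (ih.union (Set.finite_iUnion iha)).subset ?_
    rintro x (hx | ⟨i, hi⟩)
    · exact .inl hx
    · exact .inr (Set.mem_iUnion.2 ⟨i, hi⟩)

theorem Asrt.finite_free (A : Asrt) : {x | A.Free x}.Finite := by
  induction A with
  | expr e => exact e.finite_mentions
  | hasClass e C => exact e.finite_mentions
  | not A ih => exact ih
  | and A B ihA ihB => exact ihA.union ihB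
  | or A B ihA ihB => exact ihA.union ihB
  | imp A B ihA ihB => exact ihA.union ihB
  | all x A ih => exact ih.subset fun _ h => h.2
  | ex x A ih => exact ih.subset fun _ h => h.2
  | access e₁ e₂ => exact e₁.finite_mentions.union e₂.finite_mentions
  | internal e => exact e.finite_mentions
  | external e => exact e.finite_mentions
  | calls c e m args =>
    refine Set.Finite.union ?_ (e.finite_mentions.union ?_)
    · cases c with
      | none => exact Set.finite_empty.subset fun x ⟨_, h, _⟩ => nomatch h
      | some e' =>
        refine e'.finite_mentions.subset ?_
        rintro x ⟨_, he, hx⟩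
        cases he
        exact hx
    · refine ((List.finite_toSet args).biUnion fun e' _ => e'.finite_mentions).subset ?_
      rintro x ⟨e', he', hx⟩
      exact Set.mem_biUnion he' hx

theorem Asrt.finite_binds (A : Asrt) : {x | A.Binds x}.Finite := by
  induction A with
  | not A ih => exact ih
  | and A B ihA ihB => exact ihA.union ihB
  | or A B ihA ihB => exact ihA.union ihB
  | imp A B ihA ihB => exact ihA.union ihB
  | all x A ih => exact (Set.finite_singleton x).union ih
  | ex x A ih => exact (Set.finite_singleton x).union ih
  | _ => exact Set.finite_empty

/-- Distinct variables can be given prescribed values at once, and the modified variable map takes no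
values but these and the old ones. -/
theorem Env.exists_setList (ρ : Env) {xs : List Name} {vs : List Val} (hxs : xs.Nodup)
    (hlen : xs.length = vs.length) :
    ∃ ρ' : Env, (∀ z, z ∉ xs → ρ' z = ρ z) ∧ List.Forall₂ (fun x v => ρ' x = some v) xs vs ∧
      ∀ z v, ρ' z = some v → ρ z = some v ∨ v ∈ vs := by
  induction xs generalizing vs with
  | nil =>
    cases vs with
    | nil => exact ⟨ρ, by simp, .nil, fun z v h => .inl h⟩
    | cons => simp at hlen
  | cons x xs ih =>
    cases vs with
    | nil => simp at hlen
    | cons v vs =>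
      obtain ⟨hx, hxs⟩ := List.nodup_cons.1 hxs
      obtain ⟨ρ', h₁, h₂, h₃⟩ := ih hxs (Nat.succ.inj hlen)
      refine ⟨ρ'.set x v, fun z hz => ?_, .cons (ρ'.set_self x v) ?_, fun z w hz => ?_⟩
      · rw [List.mem_cons, not_or] at hz
        rw [Env.set_of_ne _ _ hz.1, h₁ z hz.2]
      · refine (forall₂_congr_of_mem fun z hz w => ?_).1 h₂
        rw [Env.set_of_ne _ _ (ne_of_mem_of_not_mem hz hx)]
      · by_cases hzx : z = x
        · subst hzx
          rw [Env.set_self] at hz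
          cases hz
          exact .inr List.mem_cons_self
        · rw [Env.set_of_ne _ _ hzx] at hz
          exact (h₃ z w hz).imp id (List.mem_cons_of_mem v)

/-! ### Execution -/

theorem Heap.HasClass.unique {χ : Heap} {α : Addr} {C D : ClassName} (h : χ.HasClass α C)
    (h' : χ.HasClass α D) : C = D := by
  obtain ⟨o, ho, rfl⟩ := h
  obtain ⟨o', ho', rfl⟩ := h'
  rw [ho] at ho'
  cases ho'
  rfl

theorem State.Internal.not_external {M : Module} {σ : State} (h : σ.Internal M) :
    ¬ σ.External M := by
  rintro ⟨C, hC, hM⟩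
  obtain ⟨D, hD, hM'⟩ := h
  exact hM (hC.unique hD ▸ hM')

theorem Step.hasClass {L : Module} {σ σ' : State} (h : Step L σ σ') {α : Addr} {C : ClassName}
    (hα : σ.heap.HasClass α C) : σ'.heap.HasClass α C := by
  obtain ⟨o, ho, rfl⟩ := hα
  cases h with
  | @write _ _ _ _ _ β _ _ _ _ _ _ _ _ hβ =>
    by_cases hαβ : α = β
    · subst hαβ
      cases hβ.symm.trans ho
      exact ⟨_, Function.update_self .., rfl⟩
    · exact ⟨o, (Function.update_of_ne hαβ ..).trans ho, rfl⟩
  | new _ _ hβ _ =>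
    refine ⟨o, (Function.update_of_ne ?_ ..).trans ho, rfl⟩
    rintro rfl
    cases hβ.symm.trans ho
  | _ => exact ⟨o, ho, rfl⟩

theorem steps_hasClass {L : Module} {σ σ' : State} (h : Relation.ReflTransGen (Step L) σ σ')
    {α : Addr} {C : ClassName} (hα : σ.heap.HasClass α C) : σ'.heap.HasClass α C := by
  induction h with
  | refl => exact hα
  | tail _ h ih => exact h.hasClass ih

theorem ExtStep.steps {M' M : Module} {σ σ' : State} (h : ExtStep M' M σ σ') :
    Relation.ReflTransGen (Step (M'.link M)) σ σ' := by
  obtain ⟨_, _, τ, h₁, h₂⟩ := h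
  exact (Relation.ReflTransGen.mono (fun _ _ h => h.1) _ _ h₁).tail h₂

theorem extSteps_steps {M' M : Module} {σ σ' : State}
    (h : Relation.ReflTransGen (ExtStep M' M) σ σ') :
    Relation.ReflTransGen (Step (M'.link M)) σ σ' := by
  induction h with
  | refl => exact .refl
  | tail _ h ih => exact ih.trans h.steps

theorem Arising.trans {M' M : Module} {σ σ' : State} (h : Arising M' M σ)
    (h' : Relation.ReflTransGen (ExtStep M' M) σ σ') : Arising M' M σ' := by
  obtain ⟨σ₀, h₀, h₁⟩ := h
  exact ⟨σ₀, h₀, h₁.trans h'⟩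

theorem Env.Valid.of_extSteps {M' M : Module} {σ σ' : State} {ρ : Env} (hρ : ρ.Valid σ.heap)
    (h : Relation.ReflTransGen (ExtStep M' M) σ σ') : ρ.Valid σ'.heap := by
  intro x α hx
  obtain ⟨o, ho⟩ := Option.isSome_iff_exists.1 (hρ x α hx)
  obtain ⟨o', ho', _⟩ := steps_hasClass (extSteps_steps h) ⟨o, ho, rfl⟩
  exact Option.isSome_iff_exists.2 ⟨o', ho'⟩

/-! ### Calls of internal methods by external code -/

/-- `τ` is a state during the execution of a call with result variable `w` and remaining code `s`
that was made in state `σ`: above the waiting frame of the caller, all frames execute on objects of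
classes in `M`, and the objects of other classes are as in `σ`. -/
structure DuringCall (M : Module) (σ : State) (w : Name) (s : List Stmt) (τ : State) : Prop where
  internal : τ.Internal M
  rest : ∃ up : List Frame,
    (∀ φ ∈ up, ∃ C, τ.heap.HasClass φ.self C ∧ M.Defines C) ∧
      τ.rest = up ++ ⟨σ.top.self, σ.top.vars, .await w s⟩ :: σ.rest
  hasClass : ∀ α C, σ.heap.HasClass α C → τ.heap.HasClass α C
  heap : ∀ α o, τ.heap α = some o → ¬ M.Defines o.cls → σ.heap α = some o

theorem DuringCall.length_lt {M : Module} {σ τ : State} {w : Name} {s : List Stmt}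
    (h : DuringCall M σ w s τ) : σ.rest.length < τ.rest.length := by
  obtain ⟨up, -, h⟩ := h.rest
  rw [h, List.length_append, List.length_cons]
  omega

/-- Whatever is done by internal code that leaves control on an internal object is harmless to
external objects: they are not written, and none is created. -/
theorem Step.heap_of_internal {L M : Module} {τ τ' : State} (h : Step L τ τ') (hτ : τ.Internal M)
    (hτ' : τ'.Internal M) {α : Addr} {o : Obj} (ho : τ'.heap α = some o) (hM : ¬ M.Defines o.cls) :
    τ.heap α = some o := by
  obtain ⟨C, hC, hCM⟩ := hτ
  cases h with
  | @write _ _ _ _ _ β _ _ _ _ _ _ _ hsame hβ =>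
    by_cases hαβ : α = β
    · subst hαβ
      cases (Function.update_self ..).symm.trans ho
      obtain ⟨D, hD, hD'⟩ := hsame
      cases hC.unique hD
      exact absurd (hD'.unique ⟨_, hβ, rfl⟩ ▸ hCM) hM
    · exact (Function.update_of_ne hαβ ..).symm.trans ho
  | @new _ _ _ _ _ β =>
    by_cases hαβ : α = β
    · subst hαβ
      obtain ⟨D, hD, hDM⟩ := hτ'
      exact absurd (hD.unique ⟨o, ho, rfl⟩ ▸ hDM) hM
    · exact (Function.update_of_ne hαβ ..).symm.trans ho
  | _ => exact ho

theorem DuringCall.step {L M : Module} {σ τ τ' : State} {w : Name} {s : List Stmt}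
    (h : DuringCall M σ w s τ) (hσ : σ.External M) (hs : Step L τ τ') (hτ' : τ'.Internal M) :
    DuringCall M σ w s τ' := by
  have hcls : ∀ α C, σ.heap.HasClass α C → τ'.heap.HasClass α C :=
    fun α C hα => hs.hasClass (h.hasClass α C hα)
  refine ⟨hτ', ?_, hcls, fun α o ho hM =>
    h.heap α o (hs.heap_of_internal h.internal hτ' ho hM) hM⟩
  obtain ⟨up, hup, hrest⟩ := h.rest
  have hup : ∀ φ ∈ up, ∃ C, τ'.heap.HasClass φ.self C ∧ M.Defines C := fun φ hφ =>
    (hup φ hφ).imp fun C hC => ⟨hs.hasClass hC.1, hC.2⟩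
  have htop : ∃ C, τ'.heap.HasClass τ.top.self C ∧ M.Defines C :=
    h.internal.imp fun C hC => ⟨hs.hasClass hC.1, hC.2⟩
  cases hs with
  | call | new =>
    refine ⟨_ :: up, ?_, congrArg (List.cons _) hrest⟩
    exact List.forall_mem_cons.2 ⟨htop, hup⟩
  | ret =>
    cases up with
    | nil =>
      -- The caller's own frame would be resumed, but its object is external.
      cases hrest
      obtain ⟨C, hC, hCM⟩ := hσ
      exact absurd ⟨C, hcls _ C hC, hCM⟩ hτ'.not_external
    | cons φ up =>
      cases hrest
      exact ⟨up, fun ψ hψ => hup ψ (List.mem_cons_of_mem _ hψ), rfl⟩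
  | _ => exact ⟨up, hup, hrest⟩

/-- The state `σ'` in which a call with result variable `w` and remaining code `s`, made in the state
`σ`, has returned the value `v`, objects of classes outside `M` being as in `σ`. -/
structure ReturnOf (M : Module) (σ : State) (w : Name) (s : List Stmt) (v : Val) (σ' : State) :
    Prop where
  top : σ'.top = ⟨σ.top.self, σ.top.vars.set w v, .run s⟩
  rest : σ'.rest = σ.rest
  heap : ∀ α o, σ'.heap α = some o → ¬ M.Defines o.cls → σ.heap α = some o

/-- During a call, control leaves the internal objects only by return to the caller. The two
premises on calls and creations are what isolation gives for `τ`. -/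
theorem DuringCall.return {L M : Module} {σ τ σ' : State} {w : Name} {s : List Stmt}
    (h : DuringCall M σ w s τ) (hs : Step L τ σ') (hσ' : σ'.External M)
    (hcall : ∀ x u m us s, τ.top.contn = .run (.call x u m us :: s) →
      ∀ β o, τ.top.lookup u = some (.addr β) → τ.heap β = some o → M.Defines o.cls)
    (hnew : ∀ x C us s, τ.top.contn = .run (.new x C us :: s) → M.Defines C) :
    ∃ v, ReturnOf M σ w s v σ' := by
  have htop : σ'.top.self ≠ τ.top.self := by
    intro heq
    obtain ⟨C, hC, hCM⟩ := h.internal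
    exact State.Internal.not_external ⟨C, heq ▸ hs.hasClass hC, hCM⟩ hσ'
  obtain ⟨up, hup, hrest⟩ := h.rest
  have hheap := h.heap
  cases hs with
  | call hc hu hβ _ _ _ =>
    exact absurd hσ' (State.Internal.not_external ⟨_, ⟨_, hβ, rfl⟩, hcall _ _ _ _ _ hc _ _ hu hβ⟩)
  | new hc _ _ _ =>
    exact absurd hσ' (State.Internal.not_external
      ⟨_, ⟨_, Function.update_self .., rfl⟩, hnew _ _ _ _ hc⟩)
  | ret _ _ hφ' =>
    cases up with
    | nil =>
      cases hrest
      cases hφ'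
      exact ⟨_, rfl, rfl, hheap⟩
    | cons φ up =>
      obtain ⟨rfl, -⟩ := List.cons.inj hrest
      obtain ⟨C, hC⟩ := hup _ List.mem_cons_self
      exact absurd hσ' (State.Internal.not_external ⟨C, hC⟩)
  | _ => exact absurd rfl htop

/-- If an external state is about to call a method of an internal object, the next external state is
the one in which this call has returned. -/
theorem ExtStep.completes_call {M' M : Module} (hM : M.Isolated) (hdisj : M'.Disjoint M)
    {σ σ' : State} (harise : Arising M' M σ) (hstep : ExtStep M' M σ σ')
    {w : Name} {u : Opd} {m : MethName} {us : List Opd} {s : List Stmt}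
    (hcontn : σ.top.contn = .run (.call w u m us :: s)) {β : Addr} {C : ClassName}
    (hu : σ.top.lookup u = some (.addr β)) (hβ : σ.heap.HasClass β C) (hC : M.Defines C) :
    ∃ v, ReturnOf M σ w s v σ' ∧ CallCompletes (M'.link M) σ w σ' := by
  obtain ⟨σ₀, hσ₀, harise⟩ := harise
  obtain ⟨hσ, hσ', τ, hτ, hlast⟩ := hstep
  -- The call leads to a state of the called method, which is internal.
  have first : ∀ τ', Step (M'.link M) σ τ' → DuringCall M σ w s τ' := by
    intro τ' hs
    have hcls : ∀ α C, σ.heap.HasClass α C → τ'.heap.HasClass α C := fun _ _ => hs.hasClass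
    cases hs with
    | call hc hu' hβ' _ _ _ =>
      cases hc.symm.trans hcontn
      cases hu'.symm.trans hu
      exact ⟨⟨C, hβ, hC⟩, ⟨[], by simp, rfl⟩, hcls, fun _ _ h _ => h⟩
    | read hc => cases hc.symm.trans hcontn
    | write hc => cases hc.symm.trans hcontn
    | new hc => cases hc.symm.trans hcontn
    | ret hc => cases hc.symm.trans hcontn
    | _ => cases hcontn
  have during : τ = σ ∨ (DuringCall M σ w s τ ∧ Relation.ReflTransGen (fun τ₁ τ₂ =>
      Step (M'.link M) τ₁ τ₂ ∧ σ.rest.length < τ₂.rest.length) σ τ) := by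
    clear hlast
    induction hτ with
    | refl => exact .inl rfl
    | tail _ h ih =>
      right
      obtain rfl | ⟨hd, hpath⟩ := ih
      · exact ⟨first _ h.1, .single ⟨h.1, (first _ h.1).length_lt⟩⟩
      · have hd' := hd.step hσ h.1 h.2
        exact ⟨hd', hpath.tail ⟨h.1, hd'.length_lt⟩⟩
  obtain rfl | ⟨hd, hpath⟩ := during
  · exact absurd hσ' (first _ hlast).internal.not_external
  · have hreach := (extSteps_steps harise).trans (Relation.ReflTransGen.mono (fun _ _ h => h.1) _ _ hτ)
    obtain ⟨hcall, hnew⟩ := hM M' hdisj σ₀ τ hσ₀ hreach hd.internal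
    obtain ⟨v, hv⟩ := hd.return hlast hσ' hcall hnew
    exact ⟨v, hv, ⟨u, m, us, s, hcontn⟩, τ, hpath, hlast, congrArg List.length hv.rest⟩

/-- A call that is executed goes to a method that the class of the receiver has, and there are as
many arguments as parameters. -/
theorem ExtStep.exists_method {M' M : Module} {σ σ' : State} (hstep : ExtStep M' M σ σ')
    {w : Name} {u : Opd} {m : MethName} {us : List Opd} {s : List Stmt}
    (hcontn : σ.top.contn = .run (.call w u m us :: s)) {β : Addr} {C : ClassName}
    (hu : σ.top.lookup u = some (.addr β)) (hβ : σ.heap.HasClass β C) (hC : M.Defines C) :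
    ∃ cd md, M C = some cd ∧ cd.methods m = some md ∧ us.length = md.params.length := by
  obtain ⟨-, -, τ, hτ, hlast⟩ := hstep
  have hfirst : ∃ τ', Step (M'.link M) σ τ' := by
    obtain rfl | ⟨τ', h, -⟩ := hτ.cases_head
    · exact ⟨σ', hlast⟩
    · exact ⟨τ', h.1⟩
  obtain ⟨τ', hs⟩ := hfirst
  cases hs with
  | @call _ _ _ _ _ _ _ o _ _ _ _ _ hc hu' hβ' hcd hmd hargs =>
    cases hc.symm.trans hcontn
    cases hu'.symm.trans hu
    cases hβ.unique ⟨o, hβ', rfl⟩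
    obtain ⟨cd', hcd'⟩ := Option.isSome_iff_exists.1 hC
    rw [Module.link, hcd', Option.some_or] at hcd
    cases hcd
    refine ⟨_, _, hcd', hmd, ?_⟩
    have := congrArg List.length hargs.1
    rw [List.length_map, List.length_map] at this
    exact this.trans hargs.2.length_eq
  | read hc => cases hc.symm.trans hcontn
  | write hc => cases hc.symm.trans hcontn
  | new hc => cases hc.symm.trans hcontn
  | ret hc => cases hc.symm.trans hcontn
  | _ => cases hcontn

/-! ### Single external steps -/

section OneStep

variable {M : Module} {A₁ A₂ A₃ P P₁ P₂ : Asrt} {x y : Name} {C : ClassName} {m : MethName}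
  {zs : List Name}

/-- An external step from a state that satisfies `x : C` and calls `x.m(zs)` returns from this call,
and its end satisfies the postcondition of a triple whose precondition holds. -/
theorem ValidTriple.of_extStep (hM : M.Isolated) (hC : M.Defines C) {Q : Asrt}
    (ht : ValidTriple M P x m zs Q) {M' : Module} (hdisj : M'.Disjoint M) {σ σ' : State} {ρ : Env}
    (harise : Arising M' M σ) (hρ : ρ.Valid σ.heap) (hstep : ExtStep M' M σ σ')
    (hx : Sat M σ ρ (.hasClass (.var x) C)) (hcalls : Sat M σ ρ (.calls none (.var x) m (zs.map .var)))
    (hP : Sat M σ ρ P) :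
    ∃ w u us s v, σ.top.contn = .run (.call w u m us :: s) ∧ ReturnOf M σ w s v σ' ∧
      Sat M σ' (ρ.set res v) Q := by
  obtain ⟨-, w, u, us, s, hcontn, ⟨β, hβ, hu⟩, -⟩ := id hcalls
  obtain ⟨β', hβ', hcls⟩ := hx
  cases (eval_var.1 hβ).symm.trans (eval_var.1 hβ')
  obtain ⟨v, hv, hcc⟩ := hstep.completes_call hM hdisj harise hcontn hu hcls hC
  refine ⟨w, u, us, s, v, hcontn, hv, ht M' hdisj σ σ' ρ w v hρ hP hcalls hcc ?_⟩
  rw [hv.top]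
  exact Env.set_self ..

theorem validSpec_if1_classical (hM : M.Isolated) (hC : M.Defines C) (hres : ¬ P₂.Free res)
    (ht : ValidTriple M (.and (.hasClass (.var x) C) (.and P₁ (.not P))) x m zs (.not P₂)) :
    ValidSpec M (.onlyIf1 (P₁.andCall x C m zs) P₂ P) := by
  rintro M' hdisj σ σ' ρ harise hρ ⟨hP₁, hx, hcalls⟩ hP₂ hstep
  by_contra hP
  obtain ⟨-, -, -, -, v, -, -, hQ⟩ :=
    ht.of_extStep hM hC hdisj harise hρ hstep hx hcalls ⟨hx, hP₁, hP⟩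
  refine hQ ((sat_congr fun z hz => ?_).1 hP₂)
  exact (Env.set_of_ne _ _ fun (h : z = res) => hres (h ▸ hz)).symm

theorem sat_inside {σ : State} {ρ : Env} {v : Val} (hy : ρ y = some v) :
    Sat M σ ρ (Asrt.inside y) ↔
      ∀ α o, σ.heap α = some o → σ.Access α v → M.Defines o.cls := by
  have hy' : ∀ α, (ρ.set (y + 1) (.addr α)) y = some v := fun α =>
    (Env.set_of_ne _ _ (Nat.succ_ne_self y).symm).trans hy
  constructor
  · intro h α o ho hacc
    obtain ⟨β, D, hβ, hD, hDM⟩ := h α (Option.isSome_iff_exists.2 ⟨o, ho⟩)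
      ⟨α, v, eval_var.2 (Env.set_self ..), eval_var.2 (hy' α), hacc⟩
    cases (eval_var.1 hβ).symm.trans (Env.set_self ..)
    cases hD.unique ⟨o, ho, rfl⟩
    exact hDM
  · rintro h α hα ⟨β, v', hβ, hv', hacc⟩
    cases (eval_var.1 hβ).symm.trans (Env.set_self ..)
    cases (eval_var.1 hv').symm.trans (hy' α)
    obtain ⟨o, ho⟩ := Option.isSome_iff_exists.1 hα
    exact ⟨α, o.cls, hβ, ⟨o, ho, rfl⟩, h α o ho hacc⟩

theorem sat_inside_of_undefined {σ : State} {ρ : Env} (hy : ρ y = none) :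
    Sat M σ ρ (Asrt.inside y) := by
  rintro α - ⟨β, v, -, hv, -⟩
  have := (Env.set_of_ne ρ (.addr α) (Nat.succ_ne_self y).symm).symm.trans (eval_var.1 hv)
  cases hy.symm.trans this

/-- A completed call gives external objects access to nothing new but the returned value. -/
theorem ReturnOf.access {σ σ' : State} {w : Name} {u : Opd} {us : List Opd} {s : List Stmt}
    {v v' : Val} (h : ReturnOf M σ w s v σ') (hcontn : σ.top.contn = .run (.call w u m us :: s))
    (hv : v' ≠ v) {α : Addr} {o : Obj} (ho : σ'.heap α = some o) (hM : ¬ M.Defines o.cls)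
    (hacc : σ'.Access α v') : σ.Access α v' := by
  obtain ⟨o', f, ho', hf⟩ | ⟨φ, hφ, hself, z, hz, hlook⟩ := hacc
  · cases ho.symm.trans ho'
    exact .inl ⟨o, f, h.heap α o ho hM, hf⟩
  · right
    rw [State.frames, h.top, h.rest, List.mem_cons] at hφ
    obtain rfl | hφ := hφ
    · refine ⟨σ.top, List.mem_cons_self, hself, z, ?_, ?_⟩
      · rw [hcontn]
        obtain ⟨t, ht, hzt⟩ := hz
        exact ⟨t, List.mem_cons_of_mem _ ht, hzt⟩
      · cases z with
        | this => exact hlook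
        | var z =>
          refine (Env.set_of_ne _ _ ?_).symm.trans hlook
          rintro rfl
          cases (Env.set_self ..).symm.trans hlook
          exact hv rfl
    · exact ⟨φ, List.mem_cons_of_mem _ hφ, hself, z, hz, hlook⟩

theorem validSpec_if1_inside (hM : M.Isolated) (hC : M.Defines C)
    (ht : ValidTriple M (.and (.hasClass (.var x) C) (.not P)) x m zs
      (.not (.expr (.eq (.var res) (.var y))))) :
    ValidSpec M (.onlyIf1 ((Asrt.inside y).andCall x C m zs) (.not (Asrt.inside y)) P) := by
  rintro M' hdisj σ σ' ρ harise hρ ⟨hin, hx, hcalls⟩ hnin hstep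
  by_contra hP
  obtain ⟨w, u, us, s, v, hcontn, hret, hQ⟩ :=
    ht.of_extStep hM hC hdisj harise hρ hstep hx hcalls ⟨hx, hP⟩
  cases hy : ρ y with
  | none => exact hnin (sat_inside_of_undefined hy)
  | some v' =>
    have hv : v' ≠ v := by
      rintro rfl
      -- This holds also if `y` is the variable `res` itself.
      have hy' : ρ.set res v' y = some v' := by
        by_cases h : y = res
        · rw [h, Env.set_self]
        · rw [Env.set_of_ne _ _ h, hy]
      refine hQ ?_
      have := Eval.eq (M := M) (χ := σ'.heap) (α := σ'.top.self)
        (eval_var.2 (ρ.set_self res v')) (eval_var.2 hy')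
      rwa [decide_eq_true rfl] at this
    refine hnin ((sat_inside hy).2 fun α o ho hacc => ?_)
    by_contra hoM
    exact hoM ((sat_inside hy).1 hin α o (hret.heap α o ho hoM)
      (hret.access hcontn hv ho hoM hacc))

theorem validSpec_if1_internal {zs : ClassName → MethName → List Name}
    (hnodup : ∀ C m, (x :: zs C m).Nodup)
    (hfresh : ∀ C m, ∀ z ∈ x :: zs C m, ¬ A₁.Free z ∧ ¬ A₂.Free z ∧ ¬ A₃.Free z)
    (hlen : ∀ C cd m md, M C = some cd → cd.methods m = some md →
      (zs C m).length = md.params.length)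
    (hmeth : ∀ C cd m md, M C = some cd → cd.methods m = some md →
      ValidSpec M (.onlyIf1 (A₁.andCall x C m (zs C m)) A₂ A₃))
    (hasrt : ValidAsrt M (.imp A₁ (.not A₂))) (henc : ValidEnc M A₁ (.not A₂)) :
    ValidSpec M (.onlyIf1 A₁ A₂ A₃) := by
  intro M' hdisj σ σ' ρ harise hρ h₁ h₂ hstep
  obtain ⟨ρ', x', m, zs', hρ', ⟨-, w, u, us, s, hcontn, ⟨β, hβ, hu⟩, hargs⟩,
    β', C, hβ', hcls, hC⟩ := henc M' hdisj σ σ' ρ harise hρ hstep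
      ⟨hasrt M' hdisj σ ρ harise hρ h₁, h₁⟩ (not_not_intro h₂)
  cases (eval_var.1 hβ).symm.trans (eval_var.1 hβ')
  obtain ⟨cd, md, hcd, hmd, hus⟩ := hstep.exists_method hcontn hu hcls hC
  -- The values of the arguments; `ρ'` shows that they do not dangle.
  have hvs : ∃ vs : List Val, List.Forall₂ (fun v u => σ.top.lookup u = some v) vs us ∧
      ∀ α, Val.addr α ∈ vs → (σ.heap α).isSome := by
    rw [List.forall₂_map_left_iff] at hargs
    clear hus hcontn
    induction hargs with
    | nil => exact ⟨[], .nil, by simp⟩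
    | cons h _ ih =>
      obtain ⟨vs, hvs, hval⟩ := ih
      obtain ⟨v, hv, hlook⟩ := h
      refine ⟨v :: vs, .cons hlook hvs, fun α hα => ?_⟩
      obtain rfl | hα := List.mem_cons.1 hα
      · exact hρ' _ _ (eval_var.1 hv)
      · exact hval α hα
  obtain ⟨vs, hvs, hval⟩ := hvs
  obtain ⟨ρ₁, hoff, hon, hrange⟩ := ρ.exists_setList (vs := .addr β :: vs) (hnodup C m) (by
    rw [List.length_cons, List.length_cons, hlen C cd m md hcd hmd, hvs.length_eq, hus])
  obtain ⟨hx, hzs⟩ := List.forall₂_cons.1 hon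
  have agree : ∀ A : Asrt, (∀ z ∈ x :: zs C m, ¬ A.Free z) → ∀ τ, Sat M τ ρ A ↔ Sat M τ ρ₁ A :=
    fun A hA τ => sat_congr fun z hz => (hoff z fun hmem => hA z hmem hz).symm
  have hρ₁ : ρ₁.Valid σ.heap := by
    intro z α hz
    obtain h | h := hrange z _ hz
    · exact hρ z α h
    · obtain h | h := List.mem_cons.1 h
      · cases h
        exact hρ' _ _ (eval_var.1 hβ)
      · exact hval α h
  refine (agree A₃ (fun z hz => (hfresh C m z hz).2.2) σ).2 <|
    hmeth C cd m md hcd hmd M' hdisj σ σ' ρ₁ harise hρ₁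
      ⟨(agree A₁ (fun z hz => (hfresh C m z hz).1) σ).1 h₁, ⟨β, eval_var.2 hx, hcls⟩,
        by simp, w, u, us, s, hcontn, ⟨β, eval_var.2 hx, hu⟩, ?_⟩
      ((agree A₂ (fun z hz => (hfresh C m z hz).2.1) σ').1 h₂) hstep
  rw [List.forall₂_map_left_iff]
  clear hus hargs hcontn hlen hon hoff hrange hval
  generalize zs C m = zs at hzs
  induction hzs generalizing us with
  | nil => cases hvs; exact .nil
  | cons h _ ih =>
    cases hvs with
    | cons h' hvs => exact .cons ⟨_, eval_var.2 h, h'⟩ (ih _ hvs)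

theorem validSpec_if1_ex₁
    (h : ∀ y, ¬ A₁.Binds y → ValidSpec M (.onlyIf1 (A₁.rename x y) A₂ A₃)) :
    ValidSpec M (.onlyIf1 (.ex x A₁) A₂ A₃) := by
  rintro M' hdisj σ σ' ρ harise hρ ⟨α, hα, h₁⟩ h₂ hstep
  obtain ⟨y, hy⟩ := (A₁.finite_binds.union
    (A₁.finite_free.union (A₂.finite_free.union A₃.finite_free))).exists_notMem
  simp only [Set.mem_union, Set.mem_ofPred_eq, not_or] at hy
  obtain ⟨hyb, hy₁, hy₂, hy₃⟩ := hy
  have agree : ∀ A : Asrt, ¬ A.Free y → ∀ τ, Sat M τ ρ A ↔ Sat M τ (ρ.set y (.addr α)) A :=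
    fun A hA τ => sat_congr fun z hz => (Env.set_of_ne _ _ fun (e : z = y) => hA (e ▸ hz)).symm
  refine (agree A₃ hy₃ σ).2 (h y hyb M' hdisj σ σ' _ harise (hρ.set y hα) ?_
    ((agree A₂ hy₂ σ').1 h₂) hstep)
  refine (sat_rename hyb fun z hz => ?_).1 h₁
  split
  · next hzx => rw [hzx, Env.set_self, Env.set_self]
  · next hzx => rw [Env.set_of_ne _ _ hzx, Env.set_of_ne _ _ fun (e : z = y) => hy₁ (e ▸ hz)]

end OneStep

/-! ### Paths of external steps -/

section Paths

variable {M M' : Module} {A A' A₁ A₂ A₃ : Asrt}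

theorem exists_path {σ σ' : State} (h : Relation.ReflTransGen (ExtStep M' M) σ σ') :
    ∃ (n : ℕ) (f : ℕ → State), f 0 = σ ∧ f n = σ' ∧ ∀ i < n, ExtStep M' M (f i) (f (i + 1)) := by
  induction h using Relation.ReflTransGen.head_induction_on with
  | refl => exact ⟨0, fun _ => σ', rfl, rfl, by simp⟩
  | @head a _ h _ ih =>
    obtain ⟨n, f, rfl, hn, hf⟩ := ih
    refine ⟨n + 1, fun k => k.casesOn a f, rfl, hn, fun i hi => ?_⟩
    cases i with
    | zero => exact h
    | succ i => exact hf i (Nat.lt_of_succ_lt_succ hi)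

theorem path_extSteps {n : ℕ} {f : ℕ → State} (hf : ∀ i < n, ExtStep M' M (f i) (f (i + 1)))
    {i : ℕ} (hi : i ≤ n) : Relation.ReflTransGen (ExtStep M' M) (f 0) (f i) := by
  induction i with
  | zero => exact .refl
  | succ i ih => exact (ih (Nat.le_of_succ_le hi)).tail (hf i hi)

theorem not_sat_false {σ : State} {ρ : Env} : ¬ Sat M σ ρ Asrt.false := by
  intro h
  cases (h : Eval M σ.heap σ.top.self ρ (.bool false) (.bool true))

theorem validSpec_if1_orE (h : ValidSpec M (.onlyIf1 A₁ A₂ (.or A A')))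
    (h' : ValidSpec M (.onlyThrough A' A₂ Asrt.false)) : ValidSpec M (.onlyIf1 A₁ A₂ A) := by
  intro M' hdisj σ σ' ρ harise hρ h₁ h₂ hstep
  refine (h M' hdisj σ σ' ρ harise hρ h₁ h₂ hstep).resolve_right fun hA' => ?_
  obtain ⟨n, f, rfl, rfl, hf⟩ := exists_path (.single hstep)
  obtain ⟨i, -, hi⟩ := h' M' hdisj n f ρ harise hρ hA' h₂ hf
  exact not_sat_false hi

/-- Along a path from `A` to `¬ A` some single step leads from `A` to `¬ A`. -/
theorem validSpec_changes (h : ValidSpec M (.onlyIf1 A (.not A) A')) :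
    ValidSpec M (.onlyThrough A (.not A) A') := by
  intro M' hdisj n f ρ harise hρ h₁ h₂ hf
  by_contra! hA'
  have hA : ∀ i ≤ n, Sat M (f i) ρ A := by
    intro i
    induction i with
    | zero => exact fun _ => h₁
    | succ i ih =>
      intro hi
      have hi' := Nat.le_of_succ_le hi
      by_contra hnA
      have hpath := path_extSteps hf hi'
      exact hA' i hi' (h M' hdisj _ _ ρ (harise.trans hpath) (hρ.of_extSteps hpath) (ih hi') hnA
        (hf i hi))
  exact h₂ (hA n le_rfl)

theorem validSpec_trans₁ (h : ValidSpec M (.onlyThrough A₁ A₂ A₃))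
    (h' : ValidSpec M (.onlyThrough A₁ A₃ A)) : ValidSpec M (.onlyThrough A₁ A₂ A) := by
  intro M' hdisj n f ρ harise hρ h₁ h₂ hf
  obtain ⟨i, hi, h₃⟩ := h M' hdisj n f ρ harise hρ h₁ h₂ hf
  obtain ⟨j, hj, hA⟩ := h' M' hdisj i f ρ harise hρ h₁ h₃ fun k hk => hf k (hk.trans_le hi)
  exact ⟨j, hj.trans hi, hA⟩

theorem validSpec_trans₂ (h : ValidSpec M (.onlyThrough A₁ A₂ A₃))
    (h' : ValidSpec M (.onlyThrough A₃ A₂ A)) : ValidSpec M (.onlyThrough A₁ A₂ A) := by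
  intro M' hdisj n f ρ harise hρ h₁ h₂ hf
  obtain ⟨i, hi, h₃⟩ := h M' hdisj n f ρ harise hρ h₁ h₂ hf
  have hpath := path_extSteps hf hi
  obtain ⟨j, hj, hA⟩ := h' M' hdisj (n - i) (fun k => f (i + k)) ρ (harise.trans hpath)
    (hρ.of_extSteps hpath) h₃ (by rwa [Nat.add_sub_cancel' hi]) fun k hk => hf (i + k) (by omega)
  exact ⟨i + j, by omega, hA⟩

theorem validSpec_if_trans (h : ValidSpec M (.onlyThrough A₁ A₂ A₃))
    (h' : ValidSpec M (.onlyIf A₁ A₃ A)) : ValidSpec M (.onlyIf A₁ A₂ A) := by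
  intro M' hdisj σ σ' ρ harise hρ h₁ h₂ hsteps
  obtain ⟨n, f, rfl, rfl, hf⟩ := exists_path hsteps
  obtain ⟨i, hi, h₃⟩ := h M' hdisj n f ρ harise hρ h₁ h₂ hf
  exact h' M' hdisj _ _ ρ harise hρ h₁ h₃ (path_extSteps hf hi)

theorem validSpec_if_class {x : Name} {C : ClassName} :
    ValidSpec M (.onlyIf (.hasClass (.var x) C) (.not (.hasClass (.var x) C)) Asrt.false) := by
  rintro M' - σ σ' ρ - - ⟨α, hα, hC⟩ h₂ hsteps
  exact absurd ⟨α, eval_var.2 (eval_var.1 hα), steps_hasClass (extSteps_steps hsteps) hC⟩ h₂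

end Paths

end Necessity

theorem mainTheorem1 (B : Necessity.BaseSystems) (hA : B.AsrtSound) (hE : B.EncSound)
    (hT : B.TripleSound) (M : Necessity.Module) (hM : M.Isolated) (S : Necessity.Spec)
    (h : Necessity.Proves B M S) : Necessity.ValidSpec M S := by
  induction h with
  | if1_classical hC hP₁ hP₂ hP hres ht =>
    exact Necessity.validSpec_if1_classical hM hC hres
      (hT M hM _ _ _ _ _ ⟨trivial, hP₁, hP⟩ hP₂ ht)
  | if1_inside hC hP ht =>
    exact Necessity.validSpec_if1_inside hM hC (hT M hM _ _ _ _ _ ⟨trivial, hP⟩ trivial ht)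
  | if1_internal hnodup hfresh hlen _ hasrt henc ih =>
    exact Necessity.validSpec_if1_internal hnodup hfresh hlen ih (hA M hM _ hasrt)
      (hE M hM _ _ henc)
  | if1_imp h₁ h₂ h₃ _ ih =>
    intro M' hdisj σ σ' ρ harise hρ hσ hσ' hstep
    exact hA M hM _ h₃ M' hdisj σ ρ harise hρ <|
      ih M' hdisj σ σ' ρ harise hρ (hA M hM _ h₁ M' hdisj σ ρ harise hρ hσ)
        (hA M hM _ h₂ M' hdisj σ' ρ (harise.trans (.single hstep)) (hρ.of_extSteps (.single hstep))
          hσ') hstep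
  | if1_orE _ _ ih ih' => exact Necessity.validSpec_if1_orE ih ih'
  | if1_ex₁ _ ih => exact Necessity.validSpec_if1_ex₁ ih
  | changes _ ih => exact Necessity.validSpec_changes ih
  | trans₁ _ _ ih ih' => exact Necessity.validSpec_trans₁ ih ih'
  | trans₂ _ _ ih ih' => exact Necessity.validSpec_trans₂ ih ih'
  | if_ _ ih =>
    intro M' hdisj n f ρ harise hρ h₁ h₂ hf
    exact ⟨0, n.zero_le, ih M' hdisj _ _ ρ harise hρ h₁ h₂ (Necessity.path_extSteps hf le_rfl)⟩
  | end_ => exact fun M' _ n f ρ _ _ _ h₂ _ => ⟨n, le_rfl, h₂⟩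
  | if_trans _ _ ih ih' => exact Necessity.validSpec_if_trans ih ih'
  | if_class => exact Necessity.validSpec_if_class
  | if_start => exact fun M' _ σ σ' ρ _ _ h₁ _ _ => h₁
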